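/- Throughout, an endomorphism of a $\mathrm{C}^*$-algebra $A$ is a (not necessarily unital) $^*$-homomorphism $A\to A$, "cpc" means completely positive and contractive, and a cp map $\varphi$ is order zero if $\varphi(a)\varphi(b)=0$ whenever $a,b\ge 0$ and $ab=0$. The rank of a finite-dimensional $\mathrm{C}^*$-algebra $F$ is the dimension of a maximal abelian ($^*$-)subalgebra of $F$. For $d\in\mathbb{Z}_{\ge 0}$, $\mathcal{F}\subseteq A$ finite and $\varepsilon>0$, a $(d,\mathcal{F},\varepsilon)$-decomposable system is a triple $(F,\psi,\varphi)$ where $F=F^{(0)}\oplus\dots\oplus F^{(d)}$ is a finite-dimensional $\mathrm{C}^*$-algebra, $\psi\colon A\to F$ is cpc, $\varphi\colon F\to A$ is a linear map whose restriction to each $F^{(i)}$ is cpc and order zero, and $\|\varphi(\psi(a))-a\|\le\varepsilon$ for all $a\in\mathcal{F}$; it is contractive if $\varphi$ is contractive. The nuclear dimension (respectively, decomposition rank) of $A$ is the least $d$ such that $(d,\mathcal{F},\varepsilon)$-decomposable systems (respectively, contractive ones) exist for all $\mathcal{F}$ and $\varepsilon$, and $\infty$ if there is no such $d$. Let $r_{\mathrm{nuc}}(d,\mathcal{F},\varepsilon)$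 (respectively, $r_{\mathrm{dr}}(d,\mathcal{F},\varepsilon)$) be the infimum of $\mathrm{rank}(F)$ over all (respectively, all contractive) $(d,\mathcal{F},\varepsilon)$-decomposable systems. Let $r_{\mathrm{hat}}(\mathcal{F},\varepsilon)$ be the infimum of $\mathrm{rank}(B)$ over all finite-dimensional $\mathrm{C}^*$-subalgebras $B\subseteq A$ such that for every $a\in\mathcal{F}$ there is $b\in B$ with $\|a-b\|<\varepsilon$. For an endomorphism $\alpha$ of $A$ and any such function $r(\mathcal{F},\varepsilon)$, put $$h_r(\alpha)=\sup_{\mathcal{F}}\ \sup_{\varepsilon>0}\ \limsup_{n\to\infty}\frac1n\log r\big(\mathcal{F}\cup\alpha(\mathcal{F})\cup\dots\cup\alpha^{n-1}(\mathcal{F}),\varepsilon\big),$$ where $\mathcal{F}$ ranges over all finite subsets of $A$ (with $\log 0=-\infty$, $\log\infty=\infty$). The coloured entropy $\mathrm{ht}_{\mathrm{nuc}}(\alpha)$ is $h_r(\alpha)$ for $r=r_{\mathrm{nuc}}(d,\cdot,\cdot)$ with $d$ the nuclear dimension of $A$, and $\infty$ if $A$ has infinite nuclear dimension; the contractive coloured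 entropy $\mathrm{ht}_{\mathrm{dr}}(\alpha)$ is $h_r(\alpha)$ for $r=r_{\mathrm{dr}}(d,\cdot,\cdot)$ with $d$ the decomposition rank of $A$, and $\infty$ if $A$ has infinite decomposition rank; Voiculescu's topological approximation entropy is $\mathrm{hat}(\alpha)=h_{r_{\mathrm{hat}}}(\alpha)$. **Proposition.** Let $A$ be a separable, unital AF-algebra (that is, $A$ is the closure of the union of an increasing sequence of finite-dimensional $\mathrm{C}^*$-subalgebras), and let $\alpha$ be an endomorphism of $A$. Then $$\mathrm{ht}_{\mathrm{dr}}(\alpha)=\mathrm{ht}_{\mathrm{nuc}}(\alpha)=\mathrm{hat}(\alpha).$$ -/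

import Mathlib

open scoped ENNReal

noncomputable section

namespace ColouredEntropy

universe u

/-! ### Rank of a finite-dimensional C*-algebra -/

section Rank

variable {F : Type*} [NonUnitalRing F] [StarRing F] [Module ℂ F]

/-- `D` is a maximal abelian `*`-subalgebra of `F`. -/
def IsMaximalAbelian (D : NonUnitalStarSubalgebra ℂ F) : Prop :=
  Maximal (fun E : NonUnitalStarSubalgebra ℂ F => ∀ x ∈ E, ∀ y ∈ E, x * y = y * x) D

variable (F) in
/-- The rank of a finite-dimensional C*-algebra `F`: the dimension of a maximal abelian
`*`-subalgebra. (All of these have the same dimension, so the set below is a singleton.) -/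
def rank : ℕ :=
  sSup {k : ℕ | ∃ D : NonUnitalStarSubalgebra ℂ F, IsMaximalAbelian D ∧ Module.finrank ℂ D = k}

end Rank

/-! ### Completely positive maps, order zero maps -/

section Maps

variable {A B : Type*} [NonUnitalCStarAlgebra A] [PartialOrder A] [StarOrderedRing A]
  [NonUnitalCStarAlgebra B] [PartialOrder B] [StarOrderedRing B]

/-- Completely positive and contractive. -/
def IsCPC (f : A →ₗ[ℂ] B) : Prop :=
  (∃ g : CompletelyPositiveMap A B, g.toLinearMap = f) ∧ ∀ x, ‖f x‖ ≤ ‖x‖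

/-- The map preserves orthogonality of positive elements. -/
def IsOrderZero (f : A →ₗ[ℂ] B) : Prop :=
  ∀ a b : A, 0 ≤ a → 0 ≤ b → a * b = 0 → f a * f b = 0

end Maps

/-! ### Decomposable systems, nuclear dimension and decomposition rank -/

/-- A `(d, S, ε)`-decomposable system `(F, ψ, φ)` for the C*-algebra `A`, with
`F = F 0 ⊕ ⋯ ⊕ F d` finite dimensional (summands may be zero). Every finite-dimensional C*-algebra
has a copy in each universe, and the order on a C*-algebra is determined by `StarOrderedRing`. -/
structure DecomposableSystem (A : Type u) [NonUnitalCStarAlgebra A] [PartialOrder A]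
    [StarOrderedRing A] (d : ℕ) (S : Set A) (ε : ℝ) where
  F : Fin (d + 1) → Type u
  [cstar : ∀ i, NonUnitalCStarAlgebra (F i)]
  [order : ∀ i, PartialOrder (F i)]
  [starOrdered : ∀ i, StarOrderedRing (F i)]
  [finDim : ∀ i, FiniteDimensional ℂ (F i)]
  ψ : A →ₗ[ℂ] (∀ i, F i)
  φ : (∀ i, F i) →ₗ[ℂ] A
  approx : ∀ a ∈ S, ‖φ (ψ a) - a‖ ≤ ε
  isCPC_down : IsCPC ψ
  isCPC_up : ∀ i, IsCPC (φ ∘ₗ LinearMap.single ℂ F i)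
  isOrderZero_up : ∀ i, IsOrderZero (φ ∘ₗ LinearMap.single ℂ F i)

attribute [instance] DecomposableSystem.cstar DecomposableSystem.order
  DecomposableSystem.starOrdered DecomposableSystem.finDim

/-- The system is contractive: `φ` itself (not only each restriction) is contractive. -/
def DecomposableSystem.IsContractive {A : Type u} [NonUnitalCStarAlgebra A] [PartialOrder A]
    [StarOrderedRing A] {d : ℕ} {S : Set A} {ε : ℝ} (s : DecomposableSystem A d S ε) : Prop :=
  ∀ x, ‖s.φ x‖ ≤ ‖x‖

section Dimension

variable (A : Type u) [NonUnitalCStarAlgebra A] [PartialOrder A] [StarOrderedRing A]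

/-- The nuclear dimension of `A` is at most `d`. -/
def NucDimLE (d : ℕ) : Prop :=
  ∀ (S : Finset A) (ε : ℝ), 0 < ε → Nonempty (DecomposableSystem A d (S : Set A) ε)

/-- The decomposition rank of `A` is at most `d`. -/
def DecompRankLE (d : ℕ) : Prop :=
  ∀ (S : Finset A) (ε : ℝ), 0 < ε → ∃ s : DecomposableSystem A d (S : Set A) ε, s.IsContractive

/-- The nuclear dimension of `A`. -/
def nucDim : ℕ∞ := ⨅ (d : ℕ) (_ : NucDimLE A d), (d : ℕ∞)

/-- The decomposition rank of `A`. -/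
def decompRank : ℕ∞ := ⨅ (d : ℕ) (_ : DecompRankLE A d), (d : ℕ∞)

variable {A}

/-- The decomposable rank `r_nuc(d, S, ε)`; it is `⊤` if there is no decomposable system. -/
def rNuc (d : ℕ) (S : Set A) (ε : ℝ) : ℕ∞ :=
  ⨅ s : DecomposableSystem A d S ε, (rank (∀ i, s.F i) : ℕ∞)

/-- The contractive decomposable rank `r_dr(d, S, ε)`. -/
def rDr (d : ℕ) (S : Set A) (ε : ℝ) : ℕ∞ :=
  ⨅ (s : DecomposableSystem A d S ε) (_ : s.IsContractive), (rank (∀ i, s.F i) : ℕ∞)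

end Dimension

/-- The infimum of the ranks of finite-dimensional C*-subalgebras of `A` (not required to contain
the unit of `A`) that `ε`-contain `S`. -/
def rHat {A : Type u} [NonUnitalCStarAlgebra A] (S : Set A) (ε : ℝ) : ℕ∞ :=
  ⨅ (B : NonUnitalStarSubalgebra ℂ A) (_ : FiniteDimensional ℂ B)
    (_ : ∀ a ∈ S, ∃ b ∈ B, ‖a - b‖ < ε), (rank B : ℕ∞)

/-! ### Entropies -/

/-- `S ∪ α(S) ∪ ⋯ ∪ α^(n-1)(S)`. -/
def orbitSet {A : Type*} (α : A → A) (S : Set A) (n : ℕ) : Set A :=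
  ⋃ k < n, α^[k] '' S

/-- `sup_S sup_{ε > 0} limsup_n (1 / n) log r(S ∪ α(S) ∪ ⋯ ∪ α^(n-1)(S), ε)`, with `S` ranging
over all finite subsets of `A`, for a given rank function `r`. -/
def growth {A : Type*} (r : Set A → ℝ → ℕ∞) (α : A → A) : EReal :=
  ⨆ (S : Finset A) (ε : ℝ) (_ : 0 < ε),
    Filter.limsup
      (fun n : ℕ => ENNReal.log ((r (orbitSet α (S : Set A) n) ε : ℕ∞) : ℝ≥0∞) / (n : EReal))
      Filter.atTop

section Entropy

variable {A : Type u} [NonUnitalCStarAlgebra A]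

/-- Voiculescu's topological approximation entropy. -/
def hat (α : A →⋆ₙₐ[ℂ] A) : EReal := growth rHat α

variable [PartialOrder A] [StarOrderedRing A]

open Classical in
/-- The coloured entropy: `∞` if the nuclear dimension is infinite, and otherwise computed from
`d`-decomposable ranks with `d` the nuclear dimension of `A`. -/
def htNuc (α : A →⋆ₙₐ[ℂ] A) : EReal :=
  if nucDim A = ⊤ then ⊤ else growth (rNuc (nucDim A).toNat) α

open Classical in
/-- The contractive coloured entropy: `∞` if the decomposition rank is infinite, and otherwise
computed from contractive `d`-decomposable ranks with `d` the decomposition rank of `A`. -/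
def htDr (α : A →⋆ₙₐ[ℂ] A) : EReal :=
  if decompRank A = ⊤ then ⊤ else growth (rDr (decompRank A).toNat) α

end Entropy

/-- `A` is approximately finite dimensional: the closure of an increasing union of a sequence of
finite-dimensional C*-subalgebras. -/
def IsAF (A : Type u) [NonUnitalCStarAlgebra A] : Prop :=
  ∃ B : ℕ → NonUnitalStarSubalgebra ℂ A, Monotone B ∧ (∀ n, FiniteDimensional ℂ (B n)) ∧
    Dense (⋃ n, (B n : Set A))

end ColouredEntropy

end

/-! An AF algebra has decomposition rank and nuclear dimension zero, so both coloured entropies are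
computed with one colour. It remains to close the cycle growth of `rNuc 0` ≤ growth of `rDr 0` ≤
`hat` ≤ growth of `rNuc 0`, whose first inequality is trivial.

For the second, a finite-dimensional subalgebra `B` that `ε`-contains a set is the range of a cpc
conditional expectation (`exists_conditional_expectation`). The expectation followed by the
inclusion is a contractive one-colour system with error `2ε`.

For the third, adjoin `1` to the finite set. If a one-colour system moves `1` by at most `δ < 1`,
then `φ e`, with `e` the unit of `F`, is within `δ` of `1`, hence invertible. An order zero map with
`φ e` invertible is `φ e` times a `*`-homomorphism `π` (`IsOrderZero.exists_starHom`). The range of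
`π` approximates the set, and as a quotient of `F` it has no larger rank (`rank_le_of_surjective`).
-/

/-! ### Units and spectral projections in finite-dimensional C*-algebras -/

open Filter Topology in
/-- A finite-dimensional C*-algebra is unital. -/
theorem exists_unit_of_finiteDimensional (F : Type*) [NonUnitalCStarAlgebra F]
    [FiniteDimensional ℂ F] : ∃ e : F, ∀ x, e * x = x ∧ x * e = x := by
  let _ := CStarAlgebra.spectralOrder F
  have _ := CStarAlgebra.spectralOrderedRing F
  have _ : ProperSpace F := FiniteDimensional.proper ℂ F
  have hl := CStarAlgebra.increasingApproximateUnit F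
  let u := Ultrafilter.of (CStarAlgebra.approximateUnit F)
  have hu : (u : Filter F) ≤ CStarAlgebra.approximateUnit F := Ultrafilter.of_le _
  -- The unit ball is compact, so the approximate unit converges along an ultrafilter, and its limit
  -- is a unit.
  obtain ⟨e, -, he⟩ := (isCompact_closedBall (0 : F) 1).ultrafilter_le_nhds u
    (le_principal_iff.mpr (hu hl.closedBall_mem))
  have he' : Tendsto id (u : Filter F) (𝓝 e) := he
  refine ⟨e, fun x => ⟨?_, ?_⟩⟩
  · exact tendsto_nhds_unique (he'.mul_const x) ((hl.tendsto_mul_right x).mono_left hu)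
  · exact tendsto_nhds_unique (he'.const_mul x) ((hl.tendsto_mul_left x).mono_left hu)

theorem star_eq_self_of_unit {F : Type*} [NonUnitalRing F] [StarRing F] {e : F}
    (he : ∀ x, e * x = x ∧ x * e = x) : star e = e := by
  have h := (he (star e)).2
  have h' := congrArg star h
  rw [star_mul, star_star, h] at h'
  exact h'

/-- The quasispectrum is the spectrum in the unitization, which is again finite dimensional, so it
lies among the roots of a minimal polynomial. -/
theorem quasispectrum_finite {F : Type*} [NonUnitalRing F] [Module ℂ F] [IsScalarTower ℂ F F]
    [SMulCommClass ℂ F F] [FiniteDimensional ℂ F] (x : F) : (quasispectrum ℂ x).Finite := by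
  rw [Unitization.quasispectrum_eq_spectrum_inr' ℂ ℂ x]
  have : FiniteDimensional ℂ (Unitization ℂ F) := by
    let L : ℂ × F →ₗ[ℂ] Unitization ℂ F :=
      { toFun := fun p => Unitization.inl p.1 + (p.2 : Unitization ℂ F)
        map_add' := fun p q => by ext <;> simp
        map_smul' := fun c p => by ext <;> simp }
    exact Module.Finite.of_surjective L fun y => ⟨(y.fst, y.snd), by ext <;> simp [L]⟩
  set y : Unitization ℂ F := (x : Unitization ℂ F)
  have hy : IsIntegral ℂ y := IsIntegral.of_finite ℂ y
  refine ((minpoly ℂ y).roots.toFinset.finite_toSet).subset fun z hz => ?_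
  have h := spectrum.subset_polynomial_aeval y (minpoly ℂ y) ⟨z, hz, rfl⟩
  rw [minpoly.aeval, spectrum.zero_eq] at h
  simpa [minpoly.ne_zero hy] using h

/-- Spectral decomposition of a selfadjoint element of a finite-dimensional C*-algebra. -/
theorem exists_spectral_decomposition {F : Type*} [NonUnitalCStarAlgebra F]
    [FiniteDimensional ℂ F] {x : F} (hx : IsSelfAdjoint x) :
    ∃ (s : Finset ℝ) (p : ℝ → F), (∀ t ∈ s, IsStarProjection (p t)) ∧
      (∀ t ∈ s, ∀ t' ∈ s, t ≠ t' → p t * p t' = 0) ∧ x = ∑ t ∈ s, t • p t := by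
  classical
  have hfin : (quasispectrum ℝ x).Finite := by
    rw [← quasispectrum.preimage_algebraMap ℂ]
    exact (quasispectrum_finite x).preimage (FaithfulSMul.algebraMap_injective ℝ ℂ).injOn
  -- On a finite set every function is continuous, so indicators of points yield the spectral
  -- projections. The point `0` is dropped because the non-unital calculus needs functions vanishing
  -- there.
  have hcont (f : ℝ → ℝ) : ContinuousOn f (quasispectrum ℝ x) := hfin.continuousOn f
  let χ : ℝ → ℝ → ℝ := fun t u => if u = t then 1 else 0
  let s := hfin.toFinset.erase 0
  have h0 : ∀ t ∈ s, χ t 0 = 0 := fun t ht => by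
    simp [χ, (Finset.ne_of_mem_erase ht).symm]
  refine ⟨s, fun t => cfcₙ (χ t) x, fun t ht => ⟨?_, ?_⟩, fun t ht t' ht' h => ?_, ?_⟩
  · rw [IsIdempotentElem, ← cfcₙ_mul _ _ x (hcont _) (h0 t ht) (hcont _) (h0 t ht)]
    congr 1; ext u; simp [χ]
  · exact cfcₙ_predicate _ _
  · rw [← cfcₙ_mul _ _ x (hcont _) (h0 t ht) (hcont _) (h0 t' ht')]
    rw [show (fun u => χ t u * χ t' u) = fun _ => 0 by ext u; simp only [χ]; aesop]
    exact cfcₙ_const_zero ℝ x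
  · conv_lhs => rw [← cfcₙ_id ℝ x]
    calc cfcₙ id x = cfcₙ (∑ t ∈ s, fun u => t * χ t u) x := by
          refine cfcₙ_congr fun u hu => ?_
          simp only [id, Finset.sum_apply, χ, mul_ite, mul_one, mul_zero, Finset.sum_ite_eq]
          by_cases h : u = 0 <;> simp [s, h, hu]
      _ = _ := by
          rw [cfcₙ_sum _ _ _ (fun _ _ => hcont _) (fun t ht => by simp [h0 t ht])]
          exact Finset.sum_congr rfl fun t ht => cfcₙ_const_mul t _ x (hcont _) (h0 t ht)

/-! ### Monotonicity of the rank -/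

namespace ColouredEntropy

section Rank

variable {F : Type*} [NonUnitalCStarAlgebra F] [FiniteDimensional ℂ F]

theorem bddAbove_finrank_maximalAbelian :
    BddAbove {k : ℕ | ∃ D : NonUnitalStarSubalgebra ℂ F,
      IsMaximalAbelian D ∧ Module.finrank ℂ D = k} := by
  refine ⟨Module.finrank ℂ F, ?_⟩
  rintro _ ⟨D, -, rfl⟩
  exact Submodule.finrank_le D.toSubmodule

/-- The dimension of an abelian `*`-subalgebra is at most the rank. -/
theorem finrank_le_rank (D : NonUnitalStarSubalgebra ℂ F)
    (hD : ∀ x ∈ D, ∀ y ∈ D, x * y = y * x) : Module.finrank ℂ D ≤ rank F := by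
  let P : NonUnitalStarSubalgebra ℂ F → Prop := fun E => ∀ x ∈ E, ∀ y ∈ E, x * y = y * x
  -- An abelian subalgebra of largest dimension among those containing `D` is maximal abelian.
  let T : Set ℕ := {k | ∃ E : NonUnitalStarSubalgebra ℂ F, P E ∧ D ≤ E ∧ Module.finrank ℂ E = k}
  have hT : BddAbove T := by
    refine ⟨Module.finrank ℂ F, ?_⟩
    rintro _ ⟨E, -, -, rfl⟩
    exact Submodule.finrank_le E.toSubmodule
  obtain ⟨E, hE, hDE, hk⟩ : sSup T ∈ T := Nat.sSup_mem ⟨_, D, hD, le_rfl, rfl⟩ hT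
  have hmono {E E' : NonUnitalStarSubalgebra ℂ F} (h : E ≤ E') :
      Module.finrank ℂ E ≤ Module.finrank ℂ E' :=
    Submodule.finrank_mono (s := E.toSubmodule) (t := E'.toSubmodule) h
  refine (hmono hDE).trans (le_csSup bddAbove_finrank_maximalAbelian ⟨E, ⟨hE, ?_⟩, rfl⟩)
  intro E' hE' hle
  have h : Module.finrank ℂ E' ≤ Module.finrank ℂ E :=
    hk ▸ le_csSup hT ⟨E', hE', hDE.trans hle, rfl⟩
  exact (Submodule.eq_of_le_of_finrank_le (S₁ := E.toSubmodule) (S₂ := E'.toSubmodule) hle h).ge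

/-- The rank does not increase under quotients. -/
theorem rank_le_of_surjective {B : Type*} [NonUnitalRing B] [StarRing B] [Module ℂ B]
    (π : F →⋆ₙₐ[ℂ] B) (hπ : Function.Surjective π) : rank B ≤ rank F := by
  refine csSup_le' ?_
  rintro _ ⟨D, hD, rfl⟩
  -- The kernel of `π` has a unit `q`, which is a central projection of `F`. On the complement of
  -- `qF` the map `π` is injective, so `D` lifts there to an abelian subalgebra.
  let I : NonUnitalStarSubalgebra ℂ F :=
    { carrier := {x | π x = 0}
      add_mem' := by intro x y hx hy; simp_all
      zero_mem' := by simp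
      mul_mem' := by intro x y hx hy; simp_all
      smul_mem' := by intro c x hx; simp_all
      star_mem' := by intro x hx; simp_all [map_star] }
  have hfd : FiniteDimensional ℂ I := inferInstanceAs (FiniteDimensional ℂ I.toSubmodule)
  have hcl : IsClosed (I : Set F) := Submodule.closed_of_finiteDimensional I.toSubmodule
  obtain ⟨⟨q, hqI⟩, hq⟩ := exists_unit_of_finiteDimensional I
  have hq1 : ∀ x, π x = 0 → q * x = x := fun x hx => congrArg Subtype.val (hq ⟨x, hx⟩).1
  have hq2 : ∀ x, π x = 0 → x * q = x := fun x hx => congrArg Subtype.val (hq ⟨x, hx⟩).2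
  have hqπ : π q = 0 := hqI
  have hcomm : ∀ x, q * x = x * q := fun x => by
    rw [← hq2 (q * x) (by simp [hqπ]), mul_assoc, hq1 (x * q) (by simp [hqπ])]
  have hqs : star q = q := congrArg Subtype.val (star_eq_self_of_unit hq)
  let D' : NonUnitalStarSubalgebra ℂ F :=
    { carrier := {x | π x ∈ D ∧ q * x = 0}
      add_mem' := by
        rintro x y ⟨hx, hx'⟩ ⟨hy, hy'⟩
        exact ⟨by simpa using add_mem hx hy, by rw [mul_add, hx', hy', add_zero]⟩
      zero_mem' := ⟨by simp, by simp⟩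
      mul_mem' := by
        rintro x y ⟨hx, hx'⟩ ⟨hy, hy'⟩
        exact ⟨by simpa using mul_mem hx hy, by rw [← mul_assoc, hx', zero_mul]⟩
      smul_mem' := by
        rintro c x ⟨hx, hx'⟩
        exact ⟨by simpa using SMulMemClass.smul_mem c hx, by rw [mul_smul_comm, hx', smul_zero]⟩
      star_mem' := by
        rintro x ⟨hx, hx'⟩
        exact ⟨by simpa [map_star] using star_mem hx,
          by rw [hcomm, ← hqs, ← star_mul, hx', star_zero]⟩ }
  have hD' : ∀ x ∈ D', ∀ y ∈ D', x * y = y * x := by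
    rintro x ⟨hx, hx'⟩ y ⟨hy, hy'⟩
    -- The commutator lies in the kernel, so `q` fixes it, but `q` also annihilates `x` and `y`.
    have h0 : π (x * y - y * x) = 0 := by
      simp [hD.prop _ hx _ hy]
    have h1 := hq1 _ h0
    rw [mul_sub, ← mul_assoc, ← mul_assoc, hx', hy', zero_mul, zero_mul, sub_zero] at h1
    exact sub_eq_zero.mp h1.symm
  refine le_trans ?_ (finrank_le_rank D' hD')
  let ρ : D' →ₗ[ℂ] D :=
    { toFun := fun x => ⟨π x, x.2.1⟩
      map_add' := fun x y => by ext; simp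
      map_smul' := fun c x => by ext; simp }
  have hfd' : FiniteDimensional ℂ D' := inferInstanceAs (FiniteDimensional ℂ D'.toSubmodule)
  refine LinearMap.finrank_le_finrank_of_surjective (f := ρ) ?_
  rintro ⟨d, hd⟩
  obtain ⟨x, rfl⟩ := hπ d
  refine ⟨⟨x - q * x, ?_, ?_⟩, ?_⟩
  · simpa [hqπ] using hd
  · rw [mul_sub, hq1 (q * x) (by simp [hqπ]), sub_self]
  · ext; simp [ρ, hqπ]

end Rank

end ColouredEntropy

/-! ### Positive functionals -/

open scoped ComplexOrder

section Functionals

variable {A : Type*} [NonUnitalCStarAlgebra A] [PartialOrder A] [StarOrderedRing A]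

/-- Positive functionals separate positive elements from zero. -/
theorem exists_positive_functional_ne_zero {x : A} (hx : 0 ≤ x) (hx0 : x ≠ 0) :
    ∃ g : A →ₚ[ℂ] ℂ, g x ≠ 0 := by
  -- This cone contains every skew-adjoint element, so a real functional that is nonnegative on it
  -- vanishes on those. Its complex extension is therefore real on selfadjoint elements and
  -- positive.
  let C : ProperCone ℝ A :=
    { carrier := {y | 0 ≤ y + star y}
      add_mem' := by
        intro y z hy hz
        have := add_nonneg hy hz
        change 0 ≤ y + z + star (y + z)
        rw [star_add]
        convert this using 1; abel
      zero_mem' := by simp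
      smul_mem' := by
        rintro ⟨c, hc⟩ y hy
        have := smul_nonneg hc hy
        simpa [smul_add] using this
      isClosed' := CStarAlgebra.isClosed_nonneg.preimage (by fun_prop) }
  have hxC : -x ∉ C := fun h => by
    have h1 : 0 ≤ -x + star (-x) := h
    rw [star_neg, (IsSelfAdjoint.of_nonneg hx).star_eq, ← neg_add, neg_nonneg] at h1
    exact hx0 (le_antisymm ((le_add_of_nonneg_left hx).trans h1) hx)
  obtain ⟨f, hf, hfx⟩ := C.hyperplane_separation_point hxC
  let g : A →ₗ[ℂ] ℂ := Module.Dual.extendRCLike (𝕜 := ℂ) f.toLinearMap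
  have hre (y : A) : (g y).re = f y := Module.Dual.re_extendRCLike_apply (𝕜 := ℂ) f.toLinearMap y
  have him (y : A) : (g y).im = -f (Complex.I • y) :=
    Module.Dual.im_extendRCLike_apply (𝕜 := ℂ) f.toLinearMap y
  refine ⟨PositiveLinearMap.mk₀ g fun y hy => ?_, fun h => ?_⟩
  · rw [Complex.nonneg_iff, hre, him]
    have hs := (IsSelfAdjoint.of_nonneg hy).star_eq
    refine ⟨hf y ?_, ?_⟩
    · change 0 ≤ y + star y
      rw [hs]; exact add_nonneg hy hy
    · have h1 : 0 ≤ f (Complex.I • y) := hf _ (show 0 ≤ _ + star _ by simp [star_smul, hs])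
      have h2 : 0 ≤ f (-(Complex.I • y)) := hf _ (show 0 ≤ _ + star _ by simp [star_smul, hs])
      rw [map_neg] at h2
      linarith
  · have h1 := hre x
    rw [show g x = 0 from h] at h1
    rw [map_neg] at hfx
    simp at h1
    linarith

/-- The left kernel of a positive functional. -/
def PositiveLinearMap.leftKernel (g : A →ₚ[ℂ] ℂ) : Submodule ℂ A where
  carrier := {x | g (star x * x) = 0}
  add_mem' := by
    intro x y hx hy
    have h1 : 0 ≤ g (star (x + y) * (x + y)) := g.map_nonneg (star_mul_self_nonneg _)
    have h2 : 0 ≤ g (star (x - y) * (x - y)) := g.map_nonneg (star_mul_self_nonneg _)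
    have h3 : g (star (x + y) * (x + y)) + g (star (x - y) * (x - y)) = 0 := by
      have hx' : g (star x * x) = 0 := hx
      have hy' : g (star y * y) = 0 := hy
      simp only [star_add, star_sub, add_mul, mul_add, sub_mul, mul_sub, map_add, map_sub, hx', hy']
      ring
    exact ((add_eq_zero_iff_of_nonneg h1 h2).mp h3).1
  zero_mem' := by simp
  smul_mem' := by
    intro c x hx
    have hx' : g (star x * x) = 0 := hx
    change g (star (c • x) * (c • x)) = 0
    rw [star_smul, smul_mul_smul_comm, map_smul, hx', smul_zero]

/-- A positive functional that is faithful on a given finite-dimensional subspace. -/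
theorem exists_positive_functional_faithful_on (V : Submodule ℂ A) [FiniteDimensional ℂ V] :
    ∃ g : A →ₚ[ℂ] ℂ, ∀ x ∈ V, g (star x * x) = 0 → x = 0 := by
  -- Choose `g` with the smallest degeneracy on `V`; if some nonzero `x` remained in it, adding a
  -- functional that detects `star x * x` would shrink it.
  let T : Set ℕ := Set.range fun g : A →ₚ[ℂ] ℂ => Module.finrank ℂ ↥(V ⊓ g.leftKernel)
  obtain ⟨g, hg⟩ : sInf T ∈ T := Nat.sInf_mem ⟨_, 0, rfl⟩
  refine ⟨g, fun x hxV hx => by_contra fun hx0 => ?_⟩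
  obtain ⟨g', hg'⟩ := exists_positive_functional_ne_zero (star_mul_self_nonneg x)
    (mt (CStarRing.star_mul_self_eq_zero_iff x).mp hx0)
  have key (y : A) : y ∈ (g + g').leftKernel ↔ y ∈ g.leftKernel ∧ y ∈ g'.leftKernel :=
    add_eq_zero_iff_of_nonneg (g.map_nonneg (star_mul_self_nonneg y))
      (g'.map_nonneg (star_mul_self_nonneg y))
  have hlt : V ⊓ (g + g').leftKernel < V ⊓ g.leftKernel := by
    refine lt_of_le_of_ne (fun y hy => ⟨hy.1, ((key y).mp hy.2).1⟩) fun h => hg' ?_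
    have hx' : x ∈ V ⊓ g.leftKernel := ⟨hxV, hx⟩
    rw [← h] at hx'
    exact ((key x).mp hx'.2).2
  have := Submodule.finiteDimensional_of_le (inf_le_left : V ⊓ g.leftKernel ≤ V)
  have h1 := Submodule.finrank_lt_finrank_of_lt hlt
  have h2 : sInf T ≤ Module.finrank ℂ ↥(V ⊓ (g + g').leftKernel) := Nat.sInf_le ⟨g + g', rfl⟩
  simp only at hg
  omega

end Functionals

/-- An orthonormal basis for an inner product given by its core. -/
theorem InnerProductSpace.Core.exists_orthonormal_expansion {V : Type*} [AddCommGroup V]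
    [Module ℂ V] [FiniteDimensional ℂ V] (c : InnerProductSpace.Core ℂ V) :
    ∃ (n : ℕ) (e : Fin n → V), ∀ x, ∑ i, c.inner (e i) x • e i = x := by
  let _ : NormedAddCommGroup V := c.toNormedAddCommGroup
  let _ : InnerProductSpace ℂ V := .ofCore c.toCore
  exact ⟨_, stdOrthonormalBasis ℂ V, fun x => (stdOrthonormalBasis ℂ V).sum_repr' x⟩

/-- A criterion for positivity in terms of a faithful positive functional. -/
theorem nonneg_of_faithful_functional {C : Type*} [NonUnitalCStarAlgebra C] [PartialOrder C]
    [StarOrderedRing C] (t : C →ₗ[ℂ] ℂ) (ht : ∀ y, 0 ≤ t (star y * y))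
    (ht' : ∀ y, t (star y * y) = 0 → y = 0) {x : C} (hx : IsSelfAdjoint x)
    (h : ∀ y, 0 ≤ t (star y * (x * y))) : 0 ≤ x := by
  rw [← CFC.negPart_eq_zero_iff x]
  set n := x⁻ with hn
  have hn0 : 0 ≤ n := CFC.negPart_nonneg x
  have hxn : x * n = -(n * n) := by
    conv_lhs => rw [← CFC.posPart_sub_negPart x hx]
    rw [sub_mul, CFC.posPart_mul_negPart, zero_sub]
  obtain ⟨r, hr⟩ := CStarAlgebra.nonneg_iff_eq_star_mul_self.mp hn0
  have hs : star n = n := (IsSelfAdjoint.of_nonneg hn0).star_eq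
  -- Testing on the negative part `n` itself gives `-t(n³) ≥ 0`, and faithfulness then forces `n =
  -- 0`.
  have h1 := h n
  have h2 : star n * (x * n) = -(star (r * n) * (r * n)) := by
    rw [hxn, star_mul, mul_neg, neg_inj, mul_assoc, ← mul_assoc (star r), ← hr]
  rw [h2, map_neg, neg_nonneg] at h1
  have h3 : r * n = 0 := ht' _ (le_antisymm h1 (ht _))
  have h4 : n * n = 0 := by
    conv_lhs => arg 1; rw [hr]
    rw [mul_assoc, h3, mul_zero]
  rw [← CStarRing.star_mul_self_eq_zero_iff, hs, h4]

theorem exists_eq_star_mul_self_of_nonneg {C : Type*} [NonUnitalCStarAlgebra C] [PartialOrder C]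
    [StarOrderedRing C] {x : C} (hx : 0 ≤ x) : ∃ y, x = star y * y :=
  CStarAlgebra.nonneg_iff_eq_star_mul_self.mp hx

/-- Compressions of positive matrices are positive. -/
theorem CStarMatrix.sum_star_mul_mul_nonneg {A : Type*} [NonUnitalCStarAlgebra A] [PartialOrder A]
    [StarOrderedRing A] {k : ℕ} {M : CStarMatrix (Fin k) (Fin k) A} (hM : 0 ≤ M) (v : Fin k → A) :
    0 ≤ ∑ i, ∑ j, star (v i) * M i j * v j := by
  obtain ⟨N, rfl⟩ := exists_eq_star_mul_self_of_nonneg hM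
  have : ∑ i, ∑ j, star (v i) * (star N * N) i j * v j =
      ∑ l, star (∑ j, N l j * v j) * ∑ j, N l j * v j := by
    simp only [CStarMatrix.mul_apply, CStarMatrix.star_apply, Finset.mul_sum, Finset.sum_mul,
      star_sum, star_mul]
    rw [Finset.sum_congr rfl fun i _ => Finset.sum_comm, Finset.sum_comm]
    refine Finset.sum_congr rfl fun l _ => ?_
    rw [Finset.sum_comm]
    simp only [mul_assoc]
  rw [this]
  exact Finset.sum_nonneg fun l _ => star_mul_self_nonneg _

/-! ### Conditional expectations onto finite-dimensional subalgebras -/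

section Expectation

variable {A B : Type*} [CStarAlgebra A] [PartialOrder A] [StarOrderedRing A]
  [NonUnitalCStarAlgebra B] [FiniteDimensional ℂ B]

/-- The inner product on `B` given by a functional on `A` which is faithful on `B`. -/
@[reducible]
noncomputable def PositiveLinearMap.innerCore (g : A →ₚ[ℂ] ℂ) (ι : B →⋆ₙₐ[ℂ] A)
    (hg : ∀ b, g (star (ι b) * ι b) = 0 → b = 0) : InnerProductSpace.Core ℂ B where
  inner a b := g (star (ι a) * ι b)
  conj_inner_symm a b := by
    rw [← Complex.star_def, ← map_star g, star_mul, star_star]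
  re_inner_nonneg b := (Complex.nonneg_iff.mp (g.map_nonneg (star_mul_self_nonneg (ι b)))).1
  add_left a b c := by rw [map_add, star_add, add_mul, map_add]
  smul_left a b c := by simp [star_smul]
  definite b hb := hg b hb

/-- A positive functional on `A` that is faithful on `B` and commutes with `B`. -/
theorem exists_central_functional (ι : B →⋆ₙₐ[ℂ] A) (hι : Function.Injective ι) :
    ∃ f : A →ₚ[ℂ] ℂ, (∀ b, f (star (ι b) * ι b) = 0 → b = 0) ∧
      ∀ a b, f (a * ι b) = f (ι b * a) := by
  obtain ⟨g, hg⟩ := exists_positive_functional_faithful_on (LinearMap.range (ι : B →ₗ[ℂ] A))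
  have hg' (b : B) (hb : g (star (ι b) * ι b) = 0) : b = 0 :=
    (map_eq_zero_iff ι hι).mp (hg (ι b) ⟨b, rfl⟩ hb)
  obtain ⟨n, e, he⟩ := (g.innerCore ι hg').exists_orthonormal_expansion
  change ∀ x, ∑ i, g (star (ι (e i)) * ι x) • e i = x at he
  -- A trace formula: on `B`, `f b` is the trace of left multiplication by `b`, computed in a basis
  -- orthonormal for the inner product of `g`.
  let f₀ : A →ₗ[ℂ] ℂ :=
    { toFun := fun a => ∑ i, g (star (ι (e i)) * a * ι (e i))
      map_add' := fun a b => by simp [mul_add, add_mul, Finset.sum_add_distrib]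
      map_smul' := fun c a => by simp [Finset.mul_sum] }
  let f : A →ₚ[ℂ] ℂ := PositiveLinearMap.mk₀ f₀ fun a ha =>
    Finset.sum_nonneg fun i _ => g.map_nonneg (star_left_conjugate_nonneg ha _)
  have hf (a : A) : f a = ∑ i, g (star (ι (e i)) * a * ι (e i)) := rfl
  refine ⟨f, fun b hb => ?_, fun a b => ?_⟩
  · have hpos (i : Fin n) : 0 ≤ g (star (ι (e i)) * (star (ι b) * ι b) * ι (e i)) :=
      g.map_nonneg (star_left_conjugate_nonneg (star_mul_self_nonneg _) _)
    rw [hf, Finset.sum_eq_zero_iff_of_nonneg fun i _ => hpos i] at hb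
    have hbe (i : Fin n) : b * e i = 0 := by
      refine hg' _ ?_
      rw [← hb i (Finset.mem_univ i), map_mul ι, star_mul]
      simp only [mul_assoc]
    have hbb : b * star b = 0 := by
      rw [← he (star b), Finset.mul_sum]
      exact Finset.sum_eq_zero fun i _ => by rw [mul_smul_comm, hbe, smul_zero]
    exact (CStarRing.mul_star_self_eq_zero_iff b).mp hbb
  · have h1 (j : Fin n) : b * e j = ∑ i, g (star (ι (e i)) * ι b * ι (e j)) • e i := by
      conv_lhs => rw [← he (b * e j)]
      simp only [map_mul, mul_assoc]
    have h2 (i : Fin n) :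
        star (e i) * b = ∑ j, g (star (ι (e i)) * ι b * ι (e j)) • star (e j) := by
      conv_lhs => rw [← star_star b, ← star_mul, ← he (star b * e i), star_sum]
      refine Finset.sum_congr rfl fun j _ => ?_
      rw [star_smul, ← map_star g, star_mul, star_star, map_mul ι, star_mul, map_star, star_star]
    have h3 (j : Fin n) : star (ι (e j)) * (a * ι b) * ι (e j) =
        ∑ i, g (star (ι (e i)) * ι b * ι (e j)) • (star (ι (e j)) * a * ι (e i)) := by
      rw [← mul_assoc, mul_assoc _ (ι b), ← map_mul, h1, map_sum, Finset.mul_sum]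
      simp only [map_smul, mul_smul_comm]
    have h4 (i : Fin n) : star (ι (e i)) * (ι b * a) * ι (e i) =
        ∑ j, g (star (ι (e i)) * ι b * ι (e j)) • (star (ι (e j)) * a * ι (e i)) := by
      have h := congrArg ι (h2 i)
      simp only [map_mul, map_star, map_sum, map_smul] at h
      rw [← mul_assoc]
      refine (congrArg (fun z => z * a * ι (e i)) h).trans ?_
      rw [Finset.sum_mul, Finset.sum_mul]
      simp only [smul_mul_assoc]
    simp only [hf, h3, h4, map_sum]
    exact Finset.sum_comm

/-- A linear map onto `B` that preserves the pairing with `B` given by a functional. -/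
theorem exists_functional_preserving_projection (ι : B →⋆ₙₐ[ℂ] A) (f : A →ₚ[ℂ] ℂ)
    (hf : ∀ b, f (star (ι b) * ι b) = 0 → b = 0) :
    ∃ E : A →ₗ[ℂ] B, ∀ b a, f (ι b * ι (E a)) = f (ι b * a) := by
  obtain ⟨n, u, hu⟩ := (f.innerCore ι hf).exists_orthonormal_expansion
  change ∀ x, ∑ i, f (star (ι (u i)) * ι x) • u i = x at hu
  -- This is the orthogonal projection onto `B` for the inner product given by `f`.
  let E : A →ₗ[ℂ] B :=
    { toFun := fun a => ∑ i, f (star (ι (u i)) * a) • u i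
      map_add' := fun a b => by simp [mul_add, add_smul, Finset.sum_add_distrib]
      map_smul' := fun c a => by simp [Finset.smul_sum, mul_smul] }
  have hE (a : A) : E a = ∑ i, f (star (ι (u i)) * a) • u i := rfl
  refine ⟨E, fun b a => ?_⟩
  have hb : ι b = ∑ i, f (ι b * ι (u i)) • star (ι (u i)) := by
    conv_lhs => rw [← star_star (ι b), ← map_star ι, ← hu (star b), map_sum, star_sum]
    refine Finset.sum_congr rfl fun i _ => ?_
    rw [map_smul, star_smul, ← map_star f, star_mul, star_star, map_star, star_star]
  conv_rhs => rw [hb, Finset.sum_mul, map_sum]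
  rw [hE, map_sum, Finset.mul_sum, map_sum]
  refine Finset.sum_congr rfl fun i _ => ?_
  rw [map_smul, mul_smul_comm, map_smul, smul_mul_assoc, map_smul, smul_eq_mul, smul_eq_mul,
    mul_comm]

variable [PartialOrder B] [StarOrderedRing B]

namespace ColouredEntropy

/-- A finite-dimensional C*-subalgebra of a unital C*-algebra is the range of a conditional
expectation. -/
theorem exists_conditional_expectation (ι : B →⋆ₙₐ[ℂ] A) (hι : Function.Injective ι) :
    ∃ E : A →ₗ[ℂ] B, IsCPC E ∧ ∀ b, E (ι b) = b := by
  obtain ⟨f, hf, hfc⟩ := exists_central_functional ι hι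
  obtain ⟨E, hE⟩ := exists_functional_preserving_projection ι f hf
  have hfpos (b : B) : 0 ≤ f (star (ι b) * ι b) := f.map_nonneg (star_mul_self_nonneg _)
  -- Elements of `B` are determined by their `f`-pairings with `B`. This reduces each algebraic
  -- identity for `E` to `hE`; the right module property and the compatibility with `star` also use
  -- that `f` commutes with `B`.
  have huniq {x y : B} (h : ∀ b, f (ι b * ι x) = f (ι b * ι y)) : x = y := by
    refine sub_eq_zero.mp (hf _ ?_)
    have := h (star (x - y))
    rw [← map_star, map_sub ι x, mul_sub, map_sub, this, sub_self]
  have hid (b : B) : E (ι b) = b := huniq fun c => hE c _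
  have hr (x : A) (b : B) : E (x * ι b) = E x * b := huniq fun c => by
    rw [hE, map_mul ι, ← mul_assoc, ← mul_assoc, hfc, hfc, ← mul_assoc, ← mul_assoc, ← map_mul ι,
      hE]
  have hl (x : A) (b : B) : E (ι b * x) = b * E x := huniq fun c => by
    rw [hE, map_mul ι, ← mul_assoc, ← mul_assoc, ← map_mul ι, hE]
  have hs (x : A) : E (star x) = star (E x) := huniq fun c => by
    rw [hE, map_star, ← star_star (ι c), ← star_mul, ← star_mul, map_star f, map_star f,
      ← map_star ι c, hfc, hfc, hE]
  obtain ⟨p, hp⟩ := exists_unit_of_finiteDimensional B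
  have hps : star p = p := star_eq_self_of_unit hp
  have hfE {z : A} (hz : 0 ≤ z) : 0 ≤ f (ι (E z)) := by
    have h : f (ι (E z)) = f (star (ι p) * z * ι p) := by
      rw [hfc, ← map_star, hps, ← mul_assoc, ← map_mul, (hp p).1, ← hE, ← map_mul, (hp _).1]
    exact h ▸ f.map_nonneg (star_left_conjugate_nonneg hz _)
  -- Positivity is tested against the faithful functional `f ∘ Tr` on matrices over `B`; the
  -- bimodule property moves the test matrix inside `E`, where it compresses `M`.
  have hcp (k : ℕ) (M : CStarMatrix (Fin k) (Fin k) A) (hM : 0 ≤ M) : 0 ≤ M.map E := by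
    let t : CStarMatrix (Fin k) (Fin k) B →ₗ[ℂ] ℂ :=
      { toFun := fun X => ∑ i, f (ι (X i i))
        map_add' := fun X Y => by simp [Finset.sum_add_distrib]
        map_smul' := fun c X => by simp [Finset.mul_sum] }
    have ht (X) : t X = ∑ i, f (ι (X i i)) := rfl
    have htt (Y) : t (star Y * Y) = ∑ i, ∑ l, f (star (ι (Y l i)) * ι (Y l i)) := by
      simp [ht, CStarMatrix.mul_apply, CStarMatrix.star_apply, map_star]
    refine nonneg_of_faithful_functional t (fun Y => ?_) (fun Y hY => ?_) ?_ fun Y => ?_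
    · rw [htt]
      exact Finset.sum_nonneg fun i _ => Finset.sum_nonneg fun l _ => hfpos _
    · rw [htt, Finset.sum_eq_zero_iff_of_nonneg fun i _ => Finset.sum_nonneg fun l _ => hfpos _]
        at hY
      ext i j
      exact hf _ ((Finset.sum_eq_zero_iff_of_nonneg fun l _ => hfpos _).mp
        (hY j (Finset.mem_univ j)) i (Finset.mem_univ i))
    · ext i j
      rw [CStarMatrix.star_apply, CStarMatrix.map_apply, CStarMatrix.map_apply, ← hs,
        ← CStarMatrix.star_apply, (IsSelfAdjoint.of_nonneg hM).star_eq]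
    · rw [ht]
      refine Finset.sum_nonneg fun l _ => ?_
      have h : (star Y * (M.map E * Y)) l l =
          E (∑ i, ∑ j, star (ι (Y i l)) * M i j * ι (Y j l)) := by
        simp only [CStarMatrix.mul_apply, CStarMatrix.star_apply, CStarMatrix.map_apply, map_sum,
          Finset.mul_sum, hr, ← map_star ι, hl, mul_assoc]
      rw [h]
      exact hfE (CStarMatrix.sum_star_mul_mul_nonneg hM fun i => ι (Y i l))
  let g : CompletelyPositiveMap A B := { E with map_cstarMatrix_nonneg' := hcp }
  have hpos {z : A} (hz : 0 ≤ z) : 0 ≤ E z := map_nonneg g hz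
  refine ⟨E, ⟨⟨g, rfl⟩, fun x => ?_⟩, hid⟩
  have h1 : E 1 = p := huniq fun c => by
    rw [hE, mul_one, ← map_mul, (hp c).2]
  have hp1 : ‖p‖ ≤ 1 := (IsStarProjection.mk (hp p).1 hps).norm_le
  -- Expand the positive element `E (star (x - E x) * (x - E x))`. With `E 1 = p` this Schwarz
  -- inequality yields contractivity.
  have hschwarz : star (E x) * E x ≤ E (star x * x) := by
    have h := hpos (star_mul_self_nonneg (x - ι (E x)))
    have h' : E (star (x - ι (E x)) * (x - ι (E x))) = E (star x * x) - star (E x) * E x := by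
      rw [star_sub, sub_mul, mul_sub, mul_sub, ← map_star ι, map_sub, map_sub, map_sub, hr, hl, hs,
        hr, hid]
      abel
    rwa [h', sub_nonneg] at h
  have hle : E (star x * x) ≤ ((‖x‖ ^ 2 : ℝ) : ℂ) • p := by
    have h := hpos (sub_nonneg.mpr (CStarAlgebra.star_mul_le_algebraMap_norm_sq (a := x)))
    rwa [map_sub, Algebra.algebraMap_eq_smul_one, ← Complex.coe_smul, map_smul, h1, sub_nonneg] at h
  have hn := CStarAlgebra.norm_le_norm_of_nonneg_of_le (star_mul_self_nonneg (E x))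
    (hschwarz.trans hle)
  rw [CStarRing.norm_star_mul_self, norm_smul, Complex.norm_real, Real.norm_of_nonneg (by positivity)]
    at hn
  refine le_of_sq_le_sq ?_ (norm_nonneg x)
  nlinarith [sq_nonneg ‖x‖]

end ColouredEntropy

end Expectation

/-! ### Order zero maps -/

namespace ColouredEntropy

section OrderZero

variable {F A : Type*} [NonUnitalCStarAlgebra F] [PartialOrder F] [StarOrderedRing F]
  [FiniteDimensional ℂ F] [CStarAlgebra A] [PartialOrder A] [StarOrderedRing A]

omit [PartialOrder A] [StarOrderedRing A] in
/-- An order zero map acts on a selfadjoint element like a scaled Jordan homomorphism. -/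
theorem IsOrderZero.jordan {φ : F →ₗ[ℂ] A} (hφ : IsOrderZero φ) {e : F}
    (he : ∀ x, e * x = x ∧ x * e = x) {x : F} (hx : IsSelfAdjoint x) :
    φ x * φ x = φ e * φ (x * x) ∧ φ x * φ e = φ e * φ x := by
  have hes := star_eq_self_of_unit he
  -- Order zero is applied to the orthogonal projections `p` and `e - p`; the spectral decomposition
  -- passes from projections to selfadjoint elements.
  have hproj {p : F} (hp : IsStarProjection p) : φ p * φ e = φ p * φ p ∧ φ e * φ p = φ p * φ p := by
    have hpp : p * p = p := hp.isIdempotentElem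
    have hq : IsStarProjection (e - p) := by
      refine ⟨?_, ?_⟩
      · rw [IsIdempotentElem, sub_mul, mul_sub, mul_sub, (he p).1, (he p).2, (he e).1, hpp]
        abel
      · rw [IsSelfAdjoint, star_sub, hes, hp.isSelfAdjoint.star_eq]
    have h1 := hφ p (e - p) hp.nonneg hq.nonneg (by rw [mul_sub, (he p).2, hpp, sub_self])
    have h2 := hφ (e - p) p hq.nonneg hp.nonneg (by rw [sub_mul, (he p).1, hpp, sub_self])
    rw [map_sub, mul_sub, sub_eq_zero] at h1
    rw [map_sub, sub_mul, sub_eq_zero] at h2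
    exact ⟨h1, h2⟩
  obtain ⟨s, p, hp, horth, rfl⟩ := exists_spectral_decomposition hx
  have hsq : (∑ t ∈ s, t • p t) * ∑ t ∈ s, t • p t = ∑ t ∈ s, (t * t) • p t := by
    rw [Finset.sum_mul_sum]
    refine Finset.sum_congr rfl fun t ht => ?_
    rw [Finset.sum_eq_single_of_mem t ht fun t' ht' h => by
      rw [smul_mul_smul_comm, horth t ht t' ht' h.symm, smul_zero], smul_mul_smul_comm,
      (hp t ht).isIdempotentElem]
  have hφr (r : ℝ) (y : F) : φ (r • y) = r • φ y := by
    rw [← Complex.coe_smul, map_smul, Complex.coe_smul]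
  rw [hsq]
  simp only [map_sum, hφr]
  refine ⟨?_, ?_⟩
  · rw [Finset.sum_mul_sum, Finset.mul_sum]
    refine Finset.sum_congr rfl fun t ht => ?_
    rw [Finset.sum_eq_single_of_mem t ht fun t' ht' h => by
      rw [smul_mul_smul_comm, hφ _ _ (hp t ht).nonneg (hp t' ht').nonneg
        (horth t ht t' ht' h.symm), smul_zero], smul_mul_smul_comm, mul_smul_comm,
      (hproj (hp t ht)).2]
  · rw [Finset.sum_mul, Finset.mul_sum]
    refine Finset.sum_congr rfl fun t ht => ?_
    rw [smul_mul_assoc, mul_smul_comm, (hproj (hp t ht)).1, (hproj (hp t ht)).2]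

/-- The structure of an order zero map `φ` whose value `φ e` at the unit is invertible. -/
theorem IsOrderZero.mul_eq {φ : CompletelyPositiveMap F A} (hφ : IsOrderZero φ.toLinearMap) {e : F}
    (he : ∀ x, e * x = x ∧ x * e = x) (hu : IsUnit (φ e)) (x y : F) :
    φ x * φ e = φ e * φ x ∧ φ e * φ (x * y) = φ x * φ y := by
  have hs (z : F) : φ (star z) = star (φ z) := map_star φ z
  have hdec (z : F) : ∃ a b : F, IsSelfAdjoint a ∧ IsSelfAdjoint b ∧ z = a + Complex.I • b :=
    ⟨realPart z, imaginaryPart z, (realPart z).2, (imaginaryPart z).2,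
      (realPart_add_I_smul_imaginaryPart z).symm⟩
  have hj {a : F} (ha : IsSelfAdjoint a) : φ a * φ a = φ e * φ (a * a) ∧ φ a * φ e = φ e * φ a :=
    hφ.jordan he ha
  have hcomm (z : F) : φ z * φ e = φ e * φ z := by
    obtain ⟨a, b, ha, hb, rfl⟩ := hdec z
    simp only [map_add, map_smul, add_mul, mul_add, smul_mul_assoc, mul_smul_comm, (hj ha).2,
      (hj hb).2]
  have hes : star (φ e) = φ e := by rw [← hs, star_eq_self_of_unit he]
  have hsum (z : F) : star (φ z) * φ z + φ z * star (φ z) =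
      φ e * (φ (star z * z) + φ (z * star z)) := by
    obtain ⟨a, b, ha, hb, rfl⟩ := hdec z
    have h1 : star (a + Complex.I • b) * (a + Complex.I • b) +
        (a + Complex.I • b) * star (a + Complex.I • b) = (2 : ℂ) • (a * a) + (2 : ℂ) • (b * b) := by
      simp only [star_add, star_smul, ha.star_eq, hb.star_eq, mul_add, add_mul, smul_mul_assoc,
        mul_smul_comm, Complex.star_def, Complex.conj_I]
      match_scalars <;> simp <;> norm_num
    have h2 : star (φ (a + Complex.I • b)) * φ (a + Complex.I • b) +
        φ (a + Complex.I • b) * star (φ (a + Complex.I • b)) =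
        (2 : ℂ) • (φ a * φ a) + (2 : ℂ) • (φ b * φ b) := by
      have ha' : star (φ a) = φ a := by rw [← hs, ha.star_eq]
      have hb' : star (φ b) = φ b := by rw [← hs, hb.star_eq]
      simp only [map_add, map_smul, star_add, star_smul, ha', hb', mul_add, add_mul, smul_mul_assoc,
        mul_smul_comm, Complex.star_def, Complex.conj_I]
      match_scalars <;> simp <;> norm_num
    rw [h2, ← map_add, h1, map_add, map_smul, map_smul, mul_add, mul_smul_comm, mul_smul_comm,
      (hj ha).1, (hj hb).1]
  -- Two-positivity: apply `φ` entrywise to the positive matrix with rows `(e, z)` and `(star z,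
  -- star z * z)`, and compress by the vector `(-φ z, φ e)`.
  have hschwarz (z : F) : 0 ≤ φ e * (φ e * φ (star z * z) - star (φ z) * φ z) := by
    let N : CStarMatrix (Fin 2) (Fin 2) F := CStarMatrix.ofMatrix !![e, z; 0, 0]
    have hM := φ.map_cstarMatrix_nonneg _ (star_mul_self_nonneg N)
    have h := CStarMatrix.sum_star_mul_mul_nonneg hM ![-φ z, φ e]
    have hes' := star_eq_self_of_unit he
    have h00 : (star N * N) 0 0 = e := by
      simp [N, CStarMatrix.mul_apply, CStarMatrix.star_apply, hes', (he e).1]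
    have h01 : (star N * N) 0 1 = z := by
      simp [N, CStarMatrix.mul_apply, CStarMatrix.star_apply, hes', (he z).1]
    have h10 : (star N * N) 1 0 = star z := by
      simp [N, CStarMatrix.mul_apply, CStarMatrix.star_apply, (he (star z)).2]
    have h11 : (star N * N) 1 1 = star z * z := by
      simp [N, CStarMatrix.mul_apply, CStarMatrix.star_apply]
    simp only [Fin.sum_univ_two, CStarMatrix.map_apply, h00, h01, h10, h11, Matrix.cons_val_zero,
      Matrix.cons_val_one, hs, star_neg, hes] at h
    convert h using 1
    have c1 := hcomm z
    have c2 : star (φ z) * φ e = φ e * star (φ z) := by rw [← hs, hcomm]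
    have c3 := hcomm (star z * z)
    simp only [mul_sub, mul_neg, neg_mul, neg_neg]
    rw [c2, mul_assoc _ (φ z), c1, mul_assoc _ _ (φ e), c3, ← mul_assoc _ (φ e) (φ z), c2]
    simp only [mul_assoc]
    abel
  have hdiag (z : F) : φ e * φ (star z * z) = star (φ z) * φ z := by
    have h1 := hschwarz z
    have h2 := hschwarz (star z)
    rw [star_star, hs, star_star] at h2
    -- By the Jordan identity `hsum` the nonnegative defects of `z` and `star z` add up to zero, so
    -- both vanish; polarization then gives the full product formula.
    have h3 : φ e * (φ e * φ (star z * z) - star (φ z) * φ z) +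
        φ e * (φ e * φ (z * star z) - φ z * star (φ z)) = 0 := by
      rw [← mul_add, sub_add_sub_comm, ← mul_add, hsum z, sub_self, mul_zero]
    exact sub_eq_zero.mp (hu.mul_right_eq_zero.mp ((add_eq_zero_iff_of_nonneg h1 h2).mp h3).1)
  have hpol (z w : F) : φ e * φ (star z * w) = star (φ z) * φ w := by
    have h1 := hdiag (z + w)
    have h2 := hdiag (z + Complex.I • w)
    simp only [star_add, star_smul, add_mul, mul_add, map_add, map_smul, smul_mul_assoc,
      mul_smul_comm, hdiag] at h1 h2
    simp only [Complex.star_def, Complex.conj_I] at h2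
    have h3 : φ e * φ (star z * w) + φ e * φ (star w * z) = star (φ z) * φ w + star (φ w) * φ z := by
      linear_combination (norm := module) h1
    have h4 : Complex.I • (φ e * φ (star z * w) - φ e * φ (star w * z)) =
        Complex.I • (star (φ z) * φ w - star (φ w) * φ z) := by
      linear_combination (norm := module) h2
    have h5 := smul_right_injective A Complex.I_ne_zero h4
    have h6 : (2 : ℂ) • (φ e * φ (star z * w)) = (2 : ℂ) • (star (φ z) * φ w) := by
      rw [two_smul, two_smul]
      linear_combination (norm := module) h3 + h5
    exact smul_right_injective A two_ne_zero h6
  refine ⟨hcomm x, ?_⟩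
  have h := hpol (star x) y
  rwa [star_star, hs, star_star] at h

/-- An order zero map whose value at the unit is invertible is a multiple of a `*`-homomorphism. -/
theorem IsOrderZero.exists_starHom {φ : CompletelyPositiveMap F A}
    (hφ : IsOrderZero φ.toLinearMap) {e : F} (he : ∀ x, e * x = x ∧ x * e = x)
    (hu : IsUnit (φ e)) : ∃ π : F →⋆ₙₐ[ℂ] A, ∀ x, φ x = φ e * π x := by
  have hs (z : F) : φ (star z) = star (φ z) := map_star φ z
  have hes : star (φ e) = φ e := by rw [← hs, star_eq_self_of_unit he]
  obtain ⟨u, hu'⟩ := id hu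
  have hcomm (z : F) : φ z * ↑u⁻¹ = ↑u⁻¹ * φ z := by
    have h : Commute (φ z) (u : A) := by rw [hu']; exact (hφ.mul_eq he hu z z).1
    exact h.units_inv_right
  have hus : star (↑u⁻¹ : A) = ↑u⁻¹ := by
    have : star u = u := Units.ext (by rw [Units.coe_star, hu', hes])
    rw [← Units.coe_star_inv, this]
  refine ⟨{ toFun := fun x => ↑u⁻¹ * φ x
            map_add' := fun x y => by rw [map_add, mul_add]
            map_zero' := by simp
            map_smul' := fun c x => by simp
            map_mul' := fun x y => ?_
            map_star' := fun x => by rw [star_mul, hus, ← hs, hcomm] }, fun x => ?_⟩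
  · have h := (hφ.mul_eq he hu x y).2
    rw [← hu'] at h
    rw [mul_assoc, ← mul_assoc (φ x), hcomm, mul_assoc, ← h, Units.inv_mul_cancel_left]
  · change φ x = φ e * (↑u⁻¹ * φ x)
    rw [← hu', Units.mul_inv_cancel_left]

end OrderZero

end ColouredEntropy

/-! ### Decomposable systems versus finite-dimensional subalgebras -/

open Filter

namespace ColouredEntropy

universe u

section Systems

variable {A : Type u} [CStarAlgebra A] [PartialOrder A] [StarOrderedRing A]

theorem isCPC_starHom {B C : Type*} [NonUnitalCStarAlgebra B] [PartialOrder B] [StarOrderedRing B]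
    [NonUnitalCStarAlgebra C] [PartialOrder C] [StarOrderedRing C] (π : B →⋆ₙₐ[ℂ] C) :
    IsCPC (π : B →ₗ[ℂ] C) :=
  ⟨⟨CompletelyPositiveMapClass.toCompletelyPositiveLinearMap π, rfl⟩,
    NonUnitalStarAlgHom.norm_apply_le π⟩

theorem IsCPC.comp {B C D : Type*} [NonUnitalCStarAlgebra B] [PartialOrder B] [StarOrderedRing B]
    [NonUnitalCStarAlgebra C] [PartialOrder C] [StarOrderedRing C]
    [NonUnitalCStarAlgebra D] [PartialOrder D] [StarOrderedRing D]
    {f : C →ₗ[ℂ] D} {g : B →ₗ[ℂ] C} (hf : IsCPC f) (hg : IsCPC g) : IsCPC (f ∘ₗ g) := by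
  obtain ⟨⟨F, rfl⟩, hF⟩ := hf
  obtain ⟨⟨G, rfl⟩, hG⟩ := hg
  exact ⟨⟨⟨F.toLinearMap ∘ₗ G.toLinearMap, fun k M hM =>
    F.map_cstarMatrix_nonneg' k _ (G.map_cstarMatrix_nonneg' k M hM)⟩, rfl⟩,
    fun x => (hF _).trans (hG x)⟩

/-- The diagonal embedding into a finite power. -/
def diagonalHom (ι B : Type*) [NonUnitalNonAssocSemiring B] [StarRing B] [Module ℂ B] :
    B →⋆ₙₐ[ℂ] (ι → B) where
  toFun b _ := b
  map_smul' _ _ := rfl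
  map_zero' := rfl
  map_add' _ _ := rfl
  map_mul' _ _ := rfl
  map_star' _ := rfl

/-- A finite-dimensional subalgebra approximating `S` gives a contractive decomposable system with
one colour. -/
theorem exists_contractive_system {B : Type u} [NonUnitalCStarAlgebra B] [FiniteDimensional ℂ B]
    (ι : B →⋆ₙₐ[ℂ] A) (hι : Function.Injective ι) {S : Set A} {ε : ℝ}
    (h : ∀ a ∈ S, ∃ b, ‖a - ι b‖ < ε) :
    ∃ s : DecomposableSystem A 0 S (2 * ε), s.IsContractive ∧ rank (∀ i, s.F i) ≤ rank B := by
  let _ := CStarAlgebra.spectralOrder B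
  have _ := CStarAlgebra.spectralOrderedRing B
  obtain ⟨E, hE, hid⟩ := exists_conditional_expectation ι hι
  have hup (i : Fin (0 + 1)) : ((ι : B →ₗ[ℂ] A) ∘ₗ LinearMap.proj 0) ∘ₗ
      LinearMap.single ℂ (fun _ : Fin (0 + 1) => B) i = (ι : B →ₗ[ℂ] A) := by
    ext b
    rw [Fin.fin_one_eq_zero i]
    simp
  let s : DecomposableSystem A 0 S (2 * ε) :=
    { F := fun _ => B
      ψ := LinearMap.pi fun _ => E
      φ := (ι : B →ₗ[ℂ] A) ∘ₗ LinearMap.proj 0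
      approx := fun a ha => by
        obtain ⟨b, hb⟩ := h a ha
        change ‖ι (E a) - a‖ ≤ 2 * ε
        -- Since `E` fixes `b`, only `a - ι b` contributes, once through `ι ∘ E` and once directly,
        -- hence the error `2 * ε`.
        have h1 : ι (E a) - a = ι (E (a - ι b)) - (a - ι b) := by
          rw [map_sub E, hid, map_sub]; abel
        have h2 : ‖ι (E (a - ι b))‖ ≤ ‖a - ι b‖ :=
          (NonUnitalStarAlgHom.norm_apply_le ι _).trans (hE.2 _)
        rw [h1]
        linarith [norm_sub_le (ι (E (a - ι b))) (a - ι b)]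
      isCPC_down := (isCPC_starHom (diagonalHom (Fin (0 + 1)) B)).comp hE
      isCPC_up := fun i => by rw [hup]; exact isCPC_starHom ι
      isOrderZero_up := fun i => by
        rw [hup]
        intro a b _ _ hab
        change ι a * ι b = 0
        rw [← map_mul, hab, map_zero] }
  refine ⟨s, fun x => ?_, ?_⟩
  · exact (NonUnitalStarAlgHom.norm_apply_le ι _).trans (norm_le_pi_norm x 0)
  · refine rank_le_of_surjective (diagonalHom (Fin (0 + 1)) B) fun y => ⟨y 0, ?_⟩
    ext i
    rw [Fin.fin_one_eq_zero i]
    rfl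

theorem exists_contractive_system_of_subalgebra (B : NonUnitalStarSubalgebra ℂ A)
    [hB : FiniteDimensional ℂ B] {S : Set A} {ε : ℝ} (h : ∀ a ∈ S, ∃ b ∈ B, ‖a - b‖ < ε) :
    ∃ s : DecomposableSystem A 0 S (2 * ε), s.IsContractive ∧ rank (∀ i, s.F i) ≤ rank B := by
  -- Closedness is what makes `B` a C*-algebra in its own right.
  have hcl : IsClosed (B : Set A) := Submodule.closed_of_finiteDimensional B.toSubmodule
  refine exists_contractive_system (NonUnitalStarSubalgebraClass.subtype B)
    Subtype.val_injective fun a ha => ?_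
  obtain ⟨b, hb, hab⟩ := h a ha
  exact ⟨⟨b, hb⟩, hab⟩

theorem rDr_le_rHat (S : Set A) (ε : ℝ) : rDr 0 S (2 * ε) ≤ rHat S ε := by
  refine le_iInf fun B => le_iInf fun hB => le_iInf fun h => ?_
  obtain ⟨s, hs, hr⟩ := exists_contractive_system_of_subalgebra B h
  exact (iInf₂_le s hs).trans (by exact_mod_cast hr)

/-- In the unitization the norm bound reads `y ≤ 1`; conjugating by `e` turns this into `y ≤ e`. -/
theorem le_unit_of_norm_le_one {F : Type*} [NonUnitalCStarAlgebra F] [PartialOrder F]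
    [StarOrderedRing F] {e : F} (he : ∀ x, e * x = x ∧ x * e = x) {y : F} (hy : 0 ≤ y)
    (hy1 : ‖y‖ ≤ 1) : y ≤ e := by
  have hes := star_eq_self_of_unit he
  have hy' : (0 : Unitization ℂ F) ≤ y := Unitization.inr_nonneg_iff.mpr hy
  have h1 : (y : Unitization ℂ F) ≤ 1 :=
    (CStarAlgebra.norm_le_one_iff_of_nonneg _ hy').mp (by rwa [Unitization.norm_inr])
  have h2 := star_left_conjugate_le_conjugate h1 (e : Unitization ℂ F)
  rw [mul_one, ← Unitization.inr_star, ← Unitization.inr_mul, ← Unitization.inr_mul,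
    ← Unitization.inr_mul, hes, (he y).1, (he y).2, (he e).1] at h2
  exact (Unitization.inr_le_iff y e (IsSelfAdjoint.of_nonneg hy) hes).mp h2

/-- A one-colour decomposable system approximating `1` can be perturbed to a `*`-homomorphism from
its finite-dimensional algebra. -/
theorem DecomposableSystem.exists_starHom {S : Set A} {δ : ℝ} (s : DecomposableSystem A 0 S δ)
    (h1 : (1 : A) ∈ S) (hδ : δ < 1) :
    ∃ π : s.F 0 →⋆ₙₐ[ℂ] A, ∀ a ∈ S, ‖a - π (s.ψ a 0)‖ ≤ δ + δ * ‖a‖ := by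
  obtain ⟨⟨φ, hφ⟩, hφn⟩ := s.isCPC_up 0
  obtain ⟨⟨ψ, hψ⟩, hψn⟩ := s.isCPC_down
  have hφ0 := s.isOrderZero_up 0
  rw [← hφ] at hφ0 hφn
  have hval (y : ∀ i, s.F i) : s.φ y = φ (y 0) := by
    have h : φ (y 0) = s.φ (Pi.single 0 (y 0)) := LinearMap.congr_fun hφ (y 0)
    rw [h]
    congr 1
    ext i
    obtain rfl : i = 0 := Fin.fin_one_eq_zero i
    simp
  have hψ0 (a : A) : ‖s.ψ a 0‖ ≤ ‖a‖ := (norm_le_pi_norm (s.ψ a) 0).trans (hψn a)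
  have hone : ‖(1 : A)‖ ≤ 1 := (IsStarProjection.one A).norm_le
  obtain ⟨e, he⟩ := exists_unit_of_finiteDimensional (s.F 0)
  have hes := star_eq_self_of_unit he
  have hep : IsStarProjection e := ⟨(he e).1, hes⟩
  have hy : 0 ≤ s.ψ 1 0 := by
    have : 0 ≤ ψ 1 := map_nonneg ψ zero_le_one
    have h : s.ψ 1 = ψ 1 := (LinearMap.congr_fun hψ 1).symm
    rw [h]
    exact this 0
  have hle : φ (s.ψ 1 0) ≤ φ e :=
    OrderHomClass.mono φ (le_unit_of_norm_le_one he hy ((hψ0 1).trans hone))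
  have hle1 : φ e ≤ 1 := (CStarAlgebra.norm_le_one_iff_of_nonneg _ (map_nonneg φ hep.nonneg)).mp
    ((hφn e).trans hep.norm_le)
  -- From `ψ 1 ≤ e` one gets `0 ≤ 1 - φ e ≤ 1 - φ (ψ 1)`, and the system moves `1` by at most `δ`.
  have hnorm : ‖1 - φ e‖ ≤ δ := by
    refine (CStarAlgebra.norm_le_norm_of_nonneg_of_le (sub_nonneg.mpr hle1)
      (sub_le_sub_left hle 1)).trans ?_
    rw [norm_sub_rev, ← hval]
    exact s.approx 1 h1
  have hu : IsUnit (φ e) := by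
    have := isUnit_one_sub_of_norm_lt_one (hnorm.trans_lt hδ)
    rwa [sub_sub_cancel] at this
  obtain ⟨π, hπ⟩ := hφ0.exists_starHom he hu
  refine ⟨π, fun a ha => ?_⟩
  -- The first term is the error of the system, the second the cost of replacing `φ` by `π`; they
  -- give `δ` and `δ * ‖a‖`.
  have hsplit : a - π (s.ψ a 0) = (a - s.φ (s.ψ a)) - (1 - φ e) * π (s.ψ a 0) := by
    rw [hval, hπ, sub_mul, one_mul]; abel
  rw [hsplit]
  refine (norm_sub_le _ _).trans (add_le_add ?_ ?_)
  · rw [norm_sub_rev]; exact s.approx a ha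
  · refine (norm_mul_le _ _).trans (mul_le_mul hnorm ?_ (norm_nonneg _)
      ((norm_nonneg _).trans hnorm))
    exact (NonUnitalStarAlgHom.norm_apply_le π _).trans (hψ0 a)

/-- The range of the `*`-homomorphism extracted from a system for `T` is the required subalgebra.
The set `T` is allowed to exceed `S` so that it can contain `1`. -/
theorem rHat_le_rNuc {S T : Set A} {M δ ε : ℝ} (hST : S ⊆ T) (h1 : (1 : A) ∈ T)
    (hM : ∀ a ∈ S, ‖a‖ ≤ M) (hδ0 : 0 ≤ δ) (hδ : δ < 1) (hε : δ + δ * M < ε) :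
    rHat S ε ≤ rNuc 0 T δ := by
  refine le_iInf fun s => ?_
  obtain ⟨π, hπ⟩ := s.exists_starHom h1 hδ
  let B : NonUnitalStarSubalgebra ℂ A := NonUnitalStarAlgHom.range π
  have hB : FiniteDimensional ℂ B :=
    inferInstanceAs (FiniteDimensional ℂ (LinearMap.range (π : s.F 0 →ₗ[ℂ] A)))
  have hSB : ∀ a ∈ S, ∃ b ∈ B, ‖a - b‖ < ε := fun a ha => by
    refine ⟨π (s.ψ a 0), ⟨_, rfl⟩, ?_⟩
    refine (hπ a (hST ha)).trans_lt (lt_of_le_of_lt ?_ hε)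
    gcongr
    exact hM a ha
  refine (iInf_le_of_le B (iInf₂_le hB hSB)).trans ?_
  have h2 : rank B ≤ rank (s.F 0) :=
    rank_le_of_surjective (NonUnitalStarAlgHom.rangeRestrict π) fun y => by
      obtain ⟨_, x, rfl⟩ := y
      exact ⟨x, rfl⟩
  let ev : (∀ i, s.F i) →⋆ₙₐ[ℂ] s.F 0 :=
    { toFun := fun y => y 0
      map_smul' := fun _ _ => rfl
      map_zero' := rfl
      map_add' := fun _ _ => rfl
      map_mul' := fun _ _ => rfl
      map_star' := fun _ => rfl }
  have h3 : rank (s.F 0) ≤ rank (∀ i, s.F i) :=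
    rank_le_of_surjective ev fun y => ⟨Pi.single 0 y, by simp [ev]⟩
  exact_mod_cast h2.trans h3

theorem rNuc_le_rDr (d : ℕ) (S : Set A) (ε : ℝ) : rNuc d S ε ≤ rDr d S ε :=
  le_iInf₂ fun s _ => iInf_le _ s

/-- An AF algebra has decomposition rank zero. -/
theorem IsAF.decompRankLE (hA : IsAF A) : DecompRankLE A 0 := by
  intro S ε hε
  obtain ⟨B, hmono, hfd, hdense⟩ := hA
  -- Half of `ε` compensates the factor `2` in the error; by monotonicity a single stage serves the
  -- whole finite set.
  have h (a : A) : ∃ n, ∃ b ∈ B n, ‖a - b‖ < ε / 2 := by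
    obtain ⟨b, hb, hab⟩ := hdense.exists_dist_lt a (half_pos hε)
    obtain ⟨n, hn⟩ := Set.mem_iUnion.mp hb
    exact ⟨n, b, hn, by rwa [← dist_eq_norm]⟩
  choose n b hb hab using h
  have := hfd (S.sup n)
  have h := exists_contractive_system_of_subalgebra (B (S.sup n)) (S := (S : Set A))
    (ε := ε / 2) fun a ha => ⟨b a, hmono (Finset.le_sup ha) (hb a), hab a⟩
  rw [mul_div_cancel₀ ε two_ne_zero] at h
  obtain ⟨s, hs, -⟩ := h
  exact ⟨s, hs⟩

end Systems

/-! ### Comparison of growth rates -/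

section Growth

/-- The suprema absorb a change of finite set and tolerance, and the limsup ignores finitely many
`n`. -/
theorem growth_le_growth {A : Type*} {r r' : Set A → ℝ → ℕ∞} {α : A → A}
    (h : ∀ (S : Finset A) (ε : ℝ), 0 < ε → ∃ (T : Finset A) (δ : ℝ), 0 < δ ∧
      ∀ᶠ n in atTop, r (orbitSet α S n) ε ≤ r' (orbitSet α T n) δ) :
    growth r α ≤ growth r' α := by
  refine iSup_le fun S => iSup₂_le fun ε hε => ?_
  obtain ⟨T, δ, hδ, hle⟩ := h S ε hε
  refine le_iSup_of_le T (le_iSup₂_of_le δ hδ (limsup_le_limsup ?_))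
  filter_upwards [hle] with n hn
  refine EReal.div_le_div_right_of_nonneg (by positivity) (ENNReal.log_monotone ?_)
  exact_mod_cast hn

variable {A : Type u} [CStarAlgebra A] [PartialOrder A] [StarOrderedRing A]

theorem growth_rDr_le_hat (α : A →⋆ₙₐ[ℂ] A) : growth (rDr 0) α ≤ hat α :=
  growth_le_growth fun S ε hε => ⟨S, ε / 2, half_pos hε, .of_forall fun n => by
    simpa [mul_div_cancel₀] using rDr_le_rHat (orbitSet α S n) (ε / 2)⟩

theorem growth_rNuc_le_growth_rDr (d : ℕ) (α : A →⋆ₙₐ[ℂ] A) :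
    growth (rNuc d) α ≤ growth (rDr d) α :=
  growth_le_growth fun S ε hε => ⟨S, ε, hε, .of_forall fun _ => rNuc_le_rDr _ _ _⟩

omit [PartialOrder A] [StarOrderedRing A] in
theorem norm_le_of_mem_orbitSet (α : A →⋆ₙₐ[ℂ] A) {S : Set A} {M : ℝ} (hM : ∀ a ∈ S, ‖a‖ ≤ M)
    {n : ℕ} {a : A} (ha : a ∈ orbitSet α S n) : ‖a‖ ≤ M := by
  simp only [orbitSet, Set.mem_iUnion] at ha
  obtain ⟨k, -, b, hb, rfl⟩ := ha
  refine le_trans ?_ (hM b hb)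
  induction k with
  | zero => rfl
  | succ k ih =>
    rw [Function.iterate_succ_apply']
    exact (NonUnitalStarAlgHom.norm_apply_le α _).trans ih

theorem hat_le_growth_rNuc (α : A →⋆ₙₐ[ℂ] A) : hat α ≤ growth (rNuc 0) α := by
  classical
  refine growth_le_growth fun S ε hε => ?_
  obtain ⟨M, hM0, hM⟩ : ∃ M : ℝ, 0 ≤ M ∧ ∀ a ∈ (S : Set A), ‖a‖ ≤ M :=
    ⟨∑ a ∈ S, ‖a‖, by positivity, fun a ha =>
      Finset.single_le_sum (f := fun a => ‖a‖) (fun _ _ => norm_nonneg _) ha⟩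
  -- Chosen so that `δ < 1` and `δ + δ * M < ε`. The bound `M` is uniform in `n` because `α` is
  -- contractive.
  obtain ⟨δ, hδ0, hδ⟩ : ∃ δ : ℝ, 0 < δ ∧ δ < min 1 (ε / (1 + M)) :=
    exists_between (by positivity)
  refine ⟨insert 1 S, δ, hδ0, ?_⟩
  -- The orbit set is empty for `n = 0`; for `n ≥ 1` it contains `1` through the zeroth iterate,
  -- even if `α` is not unital.
  filter_upwards [eventually_ge_atTop 1] with n hn
  refine rHat_le_rNuc (M := M) ?_ ?_ (fun a ha => norm_le_of_mem_orbitSet α hM ha) hδ0.le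
    (hδ.trans_le (min_le_left _ _)) ?_
  · exact Set.iUnion₂_mono fun k _ => Set.image_mono (by simp)
  · exact Set.mem_iUnion₂.mpr ⟨0, hn, 1, by simp, rfl⟩
  · have := (lt_div_iff₀ (by positivity)).mp (hδ.trans_le (min_le_right _ _))
    linarith

theorem htDr_eq_growth (hA : IsAF A) (α : A →⋆ₙₐ[ℂ] A) : htDr α = growth (rDr 0) α := by
  have h : decompRank A = 0 := le_antisymm (iInf₂_le 0 hA.decompRankLE) bot_le
  simp [htDr, h]

theorem htNuc_eq_growth (hA : IsAF A) (α : A →⋆ₙₐ[ℂ] A) : htNuc α = growth (rNuc 0) α := by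
  have h' : NucDimLE A 0 := fun S ε hε => (hA.decompRankLE S ε hε).nonempty
  have h : nucDim A = 0 := le_antisymm (iInf₂_le 0 h') bot_le
  simp [htNuc, h]

end Growth

end ColouredEntropy

theorem proposition2p4 {A : Type*} [CStarAlgebra A] [PartialOrder A] [StarOrderedRing A]
    [TopologicalSpace.SeparableSpace A] (hA : ColouredEntropy.IsAF A) (α : A →⋆ₙₐ[ℂ] A) :
    ColouredEntropy.htDr α = ColouredEntropy.htNuc α ∧
      ColouredEntropy.htNuc α = ColouredEntropy.hat α := by
  rw [ColouredEntropy.htDr_eq_growth hA, ColouredEntropy.htNuc_eq_growth hA]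
  have h1 := ColouredEntropy.growth_rDr_le_hat α
  have h2 := ColouredEntropy.growth_rNuc_le_growth_rDr 0 α
  have h3 := ColouredEntropy.hat_le_growth_rNuc α
  exact ⟨le_antisymm (h1.trans h3) h2, le_antisymm (h2.trans h1) h3⟩
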